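/- Write $\mathbf{N}=\{1,2,\dots\}$. (1) Let $K$ be a nonempty compact convex subset of a (real) Hausdorff topological vector space, and let $(s_i)_{i\in\mathbf{N}}$ be continuous affine maps $K\to K$. If $s_j s_i = s_i s_{j+1}$ holds for all $1\le i\le j$, then $K$ contains a point fixed by all $s_i$. (2) Equivalently, the facial monoid, given by the monoid presentation $$S=\langle s_i \ (i\in\mathbf{N}) : s_j s_i = s_i s_{j+1}\ \ \forall\, 1\le i\le j\rangle,$$ is (left) amenable, in the sense that the following (equivalent) conditions hold: (a) for every Hausdorff topological vector space $V$ with an $S$-action by continuous affine transformations, every nonempty compact convex set $K\subseteq V$ preserved by $S$ contains a point fixed by $S$; (b) there is a left-invariant mean on $S$, i.e. a positive linear functional $m$ on $\ell^\infty(S)$ with $m(1)=1$ and $m(x\mapsto f(sx))=m(f)$ for all $s\in S$ and $f\in\ell^\infty(S)$; (c) for every finite set $A\subseteq S$ and every $\epsilon>0$ there is a finitely supported probability distribution $\mu$ on $S$ such that $\|s\mu-\mu\|_1<\epsilon$ for all $s\in A$, where $s\mu$ is the push-forward of $\mu$ under $x\mapsto sx$. -/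

import Mathlib

open scoped ENNReal

universe u v

/-- The defining relations `s_j s_i = s_i s_{j+1}` for `1 ≤ i ≤ j`, on words in the letters
`s_i`, `i ∈ {1, 2, …}`. -/
inductive FacialRel : FreeMonoid ℕ+ → FreeMonoid ℕ+ → Prop
  | face (i j : ℕ+) (hij : i ≤ j) :
      FacialRel (FreeMonoid.of j * FreeMonoid.of i) (FreeMonoid.of i * FreeMonoid.of (j + 1))

/-- The facial monoid `⟨ s_i : s_j s_i = s_i s_{j+1} for all 1 ≤ i ≤ j ⟩`. -/
abbrev FacialMonoid : Type := PresentedMonoid FacialRel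

/-- A self-map of a subset `K` (convex in all uses) of a real vector space is affine if it
preserves all convex combinations of two points of `K`. -/
def IsAffineSelfMap {V : Type*} [AddCommGroup V] [Module ℝ V] {K : Set V} (f : K → K) : Prop :=
  ∀ (x y z : K) (a b : ℝ), 0 ≤ a → 0 ≤ b → a + b = 1 →
    (z : V) = a • (x : V) + b • (y : V) → (f z : V) = a • (f x : V) + b • (f y : V)

/-- Every non-empty convex compact `S`-space has a fixed point. A convex compact `S`-space is a
convex compact set `K` in a Hausdorff topological vector space `V` with an `S`-action on `V` by
continuous affine transformations preserving `K`. -/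
def HasAffineFixedPointProperty (S : Type v) [Monoid S] : Prop :=
  ∀ (V : Type u) [AddCommGroup V] [Module ℝ V] [TopologicalSpace V] [IsTopologicalAddGroup V]
    [ContinuousSMul ℝ V] [T2Space V] [MulAction S V] (K : Set V),
    (∀ s : S, ∃ f : V →ᴬ[ℝ] V, ∀ x : V, f x = s • x) →
    (∀ s : S, ∀ x ∈ K, s • x ∈ K) →
    Convex ℝ K → IsCompact K → K.Nonempty →
    ∃ p ∈ K, ∀ s : S, s • p = p

/-- A mean on `X`: a positive normalized linear functional on `ℓ^∞(X)`. -/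
structure Mean (X : Type*) where
  toLinearMap : lp (fun _ : X => ℝ) ∞ →ₗ[ℝ] ℝ
  nonneg : ∀ f : lp (fun _ : X => ℝ) ∞, (∀ x, 0 ≤ f x) → 0 ≤ toLinearMap f
  map_one : toLinearMap 1 = 1

/-- The bounded function `x ↦ f (s * x)`. -/
def leftTranslate {S : Type*} [Monoid S] (s : S) (f : lp (fun _ : S => ℝ) ∞) :
    lp (fun _ : S => ℝ) ∞ :=
  ⟨fun x => f (s * x), memℓp_infty
    ((lp.memℓp f).bddAbove.mono
      (Set.range_comp_subset_range (fun x => s * x) (fun x => ‖f x‖)))⟩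

/-- There is a left-invariant mean on `S`. -/
def HasLeftInvariantMean (S : Type*) [Monoid S] : Prop :=
  ∃ m : Mean S, ∀ (s : S) (f : lp (fun _ : S => ℝ) ∞),
    m.toLinearMap (leftTranslate s f) = m.toLinearMap f

/-- There are finitely supported probability distributions `μ` on `S` that are almost invariant,
in the `ℓ¹`-norm, under left translation by any given finite set of elements. Here
`Finsupp.mapDomain (s * ·) μ` is the push-forward `s μ`. -/
def HasAlmostInvariantDistributions (S : Type*) [Monoid S] : Prop :=
  ∀ (A : Finset S) (ε : ℝ), 0 < ε →
    ∃ μ : S →₀ ℝ, (∀ x, 0 ≤ μ x) ∧ (μ.sum fun _ r => r) = 1 ∧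
      ∀ s ∈ A, ((Finsupp.mapDomain (fun x => s * x) μ - μ).sum fun _ r => |r|) < ε

/-- Left amenability of a monoid: the fixed-point property, the existence of a left-invariant
mean and the existence of almost invariant distributions. By a theorem of Day the three are
equivalent; all three are demanded, so that no use is made of that theorem. -/
structure IsLeftAmenable (S : Type v) [Monoid S] : Prop where
  fixedPoint : HasAffineFixedPointProperty.{u, v} S
  mean : HasLeftInvariantMean S
  almostInvariant : HasAlmostInvariantDistributions S

/-! Let `M` be a shift-invariant mean on `ℕ` and let `λ_n` be the law of `s_n ^ a_n * ⋯ * s_1 ^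
a_1`, the exponents being drawn successively from `M`. The relations give `s_i * s_{j+1} ^ a = s_j ^
a * s_i` for `i ≤ j`, so for `n > i` left multiplication by `s_i` lowers the indices `n, …, i + 1`
by one and leaves `s_i ^ a_{i+1} * s_i * s_i ^ a_i` in the middle. Shift invariance absorbs the lone
`s_i` and merges the two random powers into one. Hence `s_i λ_n = λ_{n-1}`
(`wordMean_leftTranslate`), and the `M`-average of the `λ_n` is invariant.

The rest is Day's theorem. Hahn–Banach separation in a finite power of `ℓ¹` turns the mean into
almost invariant distributions; averaging an orbit in `K` against these gives almost fixed points,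
which accumulate at a fixed point. Local convexity is not needed, since compact sets are von Neumann
bounded. -/

/-! ### Means and bounded functions -/

/-- The pullback of a bounded function along a map. -/
def lpInftyComp {X Y : Type*} (φ : X → Y) (f : lp (fun _ : Y => ℝ) ∞) : lp (fun _ : X => ℝ) ∞ :=
  ⟨fun x => f (φ x), memℓp_infty
    ((lp.memℓp f).bddAbove.mono (Set.range_comp_subset_range φ (fun y => ‖f y‖)))⟩

@[simp] lemma lpInftyComp_apply {X Y : Type*} (φ : X → Y) (f : lp (fun _ : Y => ℝ) ∞) (x : X) :
    lpInftyComp φ f x = f (φ x) := rfl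

@[simp] lemma leftTranslate_apply {S : Type*} [Monoid S] (s : S) (f : lp (fun _ : S => ℝ) ∞)
    (x : S) : leftTranslate s f x = f (s * x) := rfl

namespace Mean

variable {X Y : Type*}

lemma map_le (m : Mean X) (f : lp (fun _ : X => ℝ) ∞) (C : ℝ) (h : ∀ x, f x ≤ C) :
    m.toLinearMap f ≤ C := by
  have := m.nonneg (C • 1 - f) fun x =>
    show 0 ≤ C * 1 - f x by rw [mul_one]; exact sub_nonneg.2 (h x)
  rw [map_sub, map_smul, m.map_one] at this
  simpa using this

lemma le_map (m : Mean X) (f : lp (fun _ : X => ℝ) ∞) (C : ℝ) (h : ∀ x, C ≤ f x) :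
    C ≤ m.toLinearMap f := by
  have := m.nonneg (f - C • 1) fun x =>
    show 0 ≤ f x - C * 1 by rw [mul_one]; exact sub_nonneg.2 (h x)
  rw [map_sub, map_smul, m.map_one] at this
  simpa using this

lemma abs_map_le (m : Mean X) (f : lp (fun _ : X => ℝ) ∞) (C : ℝ) (h : ∀ x, |f x| ≤ C) :
    |m.toLinearMap f| ≤ C :=
  abs_le.2 ⟨m.le_map f _ fun x => (abs_le.1 (h x)).1, m.map_le f _ fun x => (abs_le.1 (h x)).2⟩

lemma map_const (m : Mean X) (f : lp (fun _ : X => ℝ) ∞) (C : ℝ) (h : ∀ x, f x = C) :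
    m.toLinearMap f = C :=
  le_antisymm (m.map_le f C fun x => (h x).le) (m.le_map f C fun x => (h x).ge)

/-- The evaluation at a point. -/
noncomputable def dirac (x : X) : Mean X where
  toLinearMap :=
    { toFun := fun f => f x
      map_add' := fun _ _ => rfl
      map_smul' := fun _ _ => rfl }
  nonneg _ h := h x
  map_one := rfl

/-- The push-forward of a mean. -/
noncomputable def map (φ : X → Y) (m : Mean X) : Mean Y where
  toLinearMap :=
    { toFun := fun f => m.toLinearMap (lpInftyComp φ f)
      map_add' := fun f g => by rw [← map_add]; rfl
      map_smul' := fun c f => by rw [← map_smul]; rfl }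
  nonneg f h := m.nonneg _ fun x => h (φ x)
  map_one := m.map_const _ _ fun _ => rfl

/-- The bounded function obtained by integrating a bounded function against a family of means. -/
noncomputable def kernel (ν : X → Mean Y) (f : lp (fun _ : Y => ℝ) ∞) : lp (fun _ : X => ℝ) ∞ :=
  ⟨fun x => (ν x).toLinearMap f, memℓp_infty ⟨‖f‖, by
    rintro _ ⟨x, rfl⟩
    exact (ν x).abs_map_le f _ fun y => lp.norm_apply_le_norm ENNReal.top_ne_zero f y⟩⟩

lemma kernel_apply (ν : X → Mean Y) (f : lp (fun _ : Y => ℝ) ∞) (x : X) :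
    kernel ν f x = (ν x).toLinearMap f := rfl

/-- The mixture of a family of means. -/
noncomputable def bind (m : Mean X) (ν : X → Mean Y) : Mean Y where
  toLinearMap :=
    { toFun := fun f => m.toLinearMap (kernel ν f)
      map_add' := fun f g => by
        rw [← map_add]; congr 1; ext x; exact map_add (ν x).toLinearMap f g
      map_smul' := fun c f => by
        rw [RingHom.id_apply, ← map_smul]; congr 1; ext x; exact map_smul (ν x).toLinearMap c f }
  nonneg f h := m.nonneg _ fun x => (ν x).nonneg f h
  map_one := m.map_const _ _ fun x => (ν x).map_one

lemma bind_apply (m : Mean X) (ν : X → Mean Y) (f : lp (fun _ : Y => ℝ) ∞) :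
    (m.bind ν).toLinearMap f = m.toLinearMap (kernel ν f) := rfl

lemma map_apply (m : Mean X) (φ : X → Y) (f : lp (fun _ : Y => ℝ) ∞) :
    (m.map φ).toLinearMap f = m.toLinearMap (lpInftyComp φ f) := rfl

end Mean

/-! ### A Banach limit -/

open Filter Topology

lemma exists_tendsto_ultrafilter_of_abs_le {ι : Type*} (U : Ultrafilter ι) (g : ι → ℝ) (C : ℝ)
    (h : ∀ n, |g n| ≤ C) : ∃ a, Tendsto g U (𝓝 a) := by
  obtain ⟨a, -, ha⟩ := (isCompact_Icc (a := -C) (b := C)).ultrafilter_le_nhds (U.map g) (by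
    rw [Ultrafilter.coe_map, le_principal_iff]
    exact Filter.mem_map.2 (Filter.univ_mem' fun n => abs_le.1 (h n)))
  exact ⟨a, ha⟩

/-- The average of the first `n + 1` values. -/
noncomputable def cesaro (f : ℕ → ℝ) (n : ℕ) : ℝ := (∑ k ∈ Finset.range (n + 1), f k) / (n + 1)

lemma abs_cesaro_le (f : ℕ → ℝ) (C : ℝ) (h : ∀ n, |f n| ≤ C) (n : ℕ) : |cesaro f n| ≤ C := by
  rw [cesaro, abs_div, abs_of_pos (by positivity : (0 : ℝ) < n + 1), div_le_iff₀ (by positivity)]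
  refine (Finset.abs_sum_le_sum_abs _ _).trans ((Finset.sum_le_card_nsmul _ _ C
    fun k _ => h k).trans (le_of_eq ?_))
  simp [mul_comm]

lemma tendsto_cesaro_shift_sub (f : ℕ → ℝ) (C : ℝ) (h : ∀ n, |f n| ≤ C) :
    Tendsto (fun n => cesaro (fun k => f (k + 1)) n - cesaro f n) atTop (𝓝 0) := by
  refine squeeze_zero_norm (a := fun n : ℕ => (2 * C) * (1 / ((n : ℝ) + 1))) (fun n => ?_) ?_
  · have : cesaro (fun k => f (k + 1)) n - cesaro f n = (f (n + 1) - f 0) / (n + 1) := by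
      rw [cesaro, cesaro, ← sub_div, ← Finset.sum_sub_distrib, Finset.sum_range_sub]
    rw [this, Real.norm_eq_abs, abs_div, abs_of_pos (by positivity : (0 : ℝ) < n + 1),
      mul_one_div]
    gcongr
    have := abs_sub (f (n + 1)) (f 0)
    linarith [h (n + 1), h 0]
  · simpa using tendsto_one_div_add_atTop_nhds_zero_nat.const_mul (2 * C)

lemma abs_apply_le_norm {X : Type*} (f : lp (fun _ : X => ℝ) ∞) (x : X) : |f x| ≤ ‖f‖ :=
  lp.norm_apply_le_norm ENNReal.top_ne_zero f x

/-- An ultralimit of Cesàro averages: a shift changes the average only by the telescoped term `(f (n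
+ 1) - f 0) / (n + 1)`. -/
lemma exists_shiftInvariant_mean : ∃ M : Mean ℕ, ∀ f : lp (fun _ : ℕ => ℝ) ∞,
    M.toLinearMap (lpInftyComp (· + 1) f) = M.toLinearMap f := by
  let U : Ultrafilter ℕ := hyperfilter ℕ
  have key (f : lp (fun _ : ℕ => ℝ) ∞) : ∃ a, Tendsto (cesaro f) U (𝓝 a) :=
    exists_tendsto_ultrafilter_of_abs_le U _ ‖f‖ (abs_cesaro_le f _ (abs_apply_le_norm f))
  choose M hM using key
  refine ⟨⟨⟨⟨M, fun f g => ?_⟩, fun c f => ?_⟩, fun f hf => ?_, ?_⟩, fun f => ?_⟩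
  · refine tendsto_nhds_unique (hM (f + g)) (((hM f).add (hM g)).congr fun n => ?_)
    simp only [cesaro, lp.coeFn_add, Pi.add_apply]
    rw [Finset.sum_add_distrib, add_div]
  · refine tendsto_nhds_unique (hM (c • f)) (((hM f).const_mul c).congr fun n => ?_)
    simp only [cesaro, lp.coeFn_smul, Pi.smul_apply, smul_eq_mul]
    rw [← Finset.mul_sum, mul_div_assoc]
  · exact ge_of_tendsto' (hM f) fun n => div_nonneg (Finset.sum_nonneg fun k _ => hf k)
      (by positivity)
  · refine tendsto_nhds_unique (hM 1) (tendsto_const_nhds.congr fun n => ?_)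
    have : (n : ℝ) + 1 ≠ 0 := by positivity
    simp [cesaro, this]
  · have h0 := (tendsto_cesaro_shift_sub f ‖f‖ (abs_apply_le_norm f)).mono_left
      (Nat.hyperfilter_le_atTop)
    exact sub_eq_zero.1 (tendsto_nhds_unique ((hM (lpInftyComp (· + 1) f)).sub (hM f)) h0)

lemma Mean.map_shift {M : Mean ℕ}
    (hM : ∀ f : lp (fun _ : ℕ => ℝ) ∞, M.toLinearMap (lpInftyComp (· + 1) f) = M.toLinearMap f)
    (k : ℕ) (f : lp (fun _ : ℕ => ℝ) ∞) :
    M.toLinearMap (lpInftyComp (· + k) f) = M.toLinearMap f := by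
  induction k generalizing f with
  | zero => rfl
  | succ k ih =>
    rw [← hM f, ← ih (lpInftyComp (· + 1) f)]
    rfl

/-! ### An invariant mean on the facial monoid -/

namespace FacialMonoid

/-- The generator of index `n + 1`. -/
def gen (n : ℕ) : FacialMonoid := PresentedMonoid.of FacialRel n.succPNat

lemma gen_mul_gen {i j : ℕ} (h : i ≤ j) : gen j * gen i = gen i * gen (j + 1) :=
  (Con.eq _).2 (ConGen.Rel.of _ _ <| FacialRel.face i.succPNat j.succPNat (Nat.succPNat_le_succPNat.2 h))

lemma gen_mul_gen_pow {i j : ℕ} (h : i ≤ j) (a : ℕ) :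
    gen i * gen (j + 1) ^ a = gen j ^ a * gen i := by
  induction a with
  | zero => simp
  | succ a ih => rw [pow_succ, ← mul_assoc, ih, mul_assoc, ← gen_mul_gen h, ← mul_assoc, pow_succ]

lemma induction_gen {p : FacialMonoid → Prop} (one : p 1)
    (mul : ∀ i x, p x → p (gen i * x)) (x : FacialMonoid) : p x := by
  induction x using PresentedMonoid.inductionOn with
  | _ w =>
    induction w using FreeMonoid.inductionOn' with
    | one => exact one
    | of_mul i w ih =>
      have := mul (i.natPred) _ ih
      rwa [gen, PNat.succPNat_natPred] at this

variable (M : Mean ℕ)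

/-- The law of `s ^ a * x`, where `s` is the generator of index `j + 1` and `a` has law `M`. -/
noncomputable def powMean (j : ℕ) (x : FacialMonoid) : Mean FacialMonoid :=
  M.map fun a => gen j ^ a * x

/-- The law of `s_n ^ a_n * ⋯ * s_1 ^ a_1`, with `a_1`, …, `a_n` drawn from `M` in this order. -/
noncomputable def wordMean : ℕ → Mean FacialMonoid
  | 0 => Mean.dirac 1
  | n + 1 => (wordMean n).bind (powMean M n)

/-- The generator passes to the right through the random power, whose index drops by one. -/
lemma kernel_leftTranslate_of_le {i j : ℕ} (h : i ≤ j) (f : lp (fun _ : FacialMonoid => ℝ) ∞) :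
    Mean.kernel (powMean M (j + 1)) (leftTranslate (gen i) f) =
      leftTranslate (gen i) (Mean.kernel (powMean M j) f) := by
  ext x
  rw [leftTranslate_apply, Mean.kernel_apply, Mean.kernel_apply, powMean, powMean, Mean.map_apply,
    Mean.map_apply]
  congr 1
  ext a
  simp only [lpInftyComp_apply, leftTranslate_apply]
  rw [← mul_assoc, gen_mul_gen_pow h, mul_assoc]

variable {M}

lemma kernel_leftTranslate_self
    (hM : ∀ f : lp (fun _ : ℕ => ℝ) ∞, M.toLinearMap (lpInftyComp (· + 1) f) = M.toLinearMap f)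
    (i : ℕ) (f : lp (fun _ : FacialMonoid => ℝ) ∞) :
    Mean.kernel (powMean M i) (leftTranslate (gen i) f) = Mean.kernel (powMean M i) f := by
  ext x
  rw [Mean.kernel_apply, Mean.kernel_apply, powMean, Mean.map_apply, Mean.map_apply,
    ← hM (lpInftyComp _ f)]
  congr 1
  ext a
  simp only [lpInftyComp_apply, leftTranslate_apply]
  rw [← mul_assoc, pow_succ']

/-- For each fixed exponent `a` of the inner factor, the product `gen i ^ b * gen i ^ a` shifts `b`
by `a`, which `M` does not see; the outer average is then over a constant. -/
lemma kernel_kernel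
    (hM : ∀ f : lp (fun _ : ℕ => ℝ) ∞, M.toLinearMap (lpInftyComp (· + 1) f) = M.toLinearMap f)
    (i : ℕ) (f : lp (fun _ : FacialMonoid => ℝ) ∞) :
    Mean.kernel (powMean M i) (Mean.kernel (powMean M i) f) = Mean.kernel (powMean M i) f := by
  ext x
  rw [Mean.kernel_apply]
  refine M.map_const _ _ fun a => ?_
  rw [lpInftyComp_apply, Mean.kernel_apply, Mean.kernel_apply, powMean, powMean, Mean.map_apply,
    Mean.map_apply, ← Mean.map_shift hM a (lpInftyComp (fun b => gen i ^ b * x) f)]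
  congr 1
  ext b
  simp only [lpInftyComp_apply]
  rw [← mul_assoc, pow_add]

/-- Induction on the number of factors to the left of the critical pair with indices `i + 1` and
`i`. At `k = 0` the pair collapses to a single power, which costs one factor of the word. -/
lemma wordMean_leftTranslate
    (hM : ∀ f : lp (fun _ : ℕ => ℝ) ∞, M.toLinearMap (lpInftyComp (· + 1) f) = M.toLinearMap f)
    (i k : ℕ) (f : lp (fun _ : FacialMonoid => ℝ) ∞) :
    (wordMean M (k + (i + 1) + 1)).toLinearMap (leftTranslate (gen i) f) =
      (wordMean M (k + (i + 1))).toLinearMap f := by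
  induction k generalizing f with
  | zero =>
    rw [Nat.zero_add, wordMean, Mean.bind_apply, kernel_leftTranslate_of_le M le_rfl, wordMean,
      Mean.bind_apply, kernel_leftTranslate_self hM, kernel_kernel hM, Mean.bind_apply]
  | succ k ih =>
    rw [show k + 1 + (i + 1) = k + (i + 1) + 1 by omega, wordMean, Mean.bind_apply,
      kernel_leftTranslate_of_le M (by omega), ih, wordMean, Mean.bind_apply]

theorem hasLeftInvariantMean : HasLeftInvariantMean FacialMonoid := by
  obtain ⟨M, hM⟩ := exists_shiftInvariant_mean
  refine ⟨M.bind (wordMean M), fun s => ?_⟩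
  induction s using induction_gen with
  | one => intro f; congr 1; ext x; simp
  | mul i s ih =>
    intro f
    have : leftTranslate (gen i * s) f = leftTranslate s (leftTranslate (gen i) f) := by
      ext x; simp [mul_assoc]
    -- Shifts by `i + 2` and `i + 1` discard the words too short for `wordMean_leftTranslate` and
    -- align the lengths on its two sides.
    rw [this, ih, Mean.bind_apply, Mean.bind_apply, ← Mean.map_shift hM (i + 1 + 1),
      ← Mean.map_shift hM (i + 1) (Mean.kernel _ f)]
    congr 1
    ext k
    exact wordMean_leftTranslate hM i k f

end FacialMonoid

/-! ### Almost invariant distributions from an invariant mean -/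

/-- Finitely supported functions as summable functions. -/
noncomputable def finsuppToLpOne (X : Type*) : (X →₀ ℝ) →ₗ[ℝ] lp (fun _ : X => ℝ) 1 where
  toFun μ := ⟨fun x => μ x, memℓp_gen (summable_of_ne_finset_zero (s := μ.support) fun x hx => by
    simp [Finsupp.notMem_support_iff.1 hx])⟩
  map_add' _ _ := rfl
  map_smul' _ _ := rfl

lemma norm_finsuppToLpOne {X : Type*} (μ : X →₀ ℝ) :
    ‖finsuppToLpOne X μ‖ = μ.sum fun _ r => |r| := by
  rw [lp.norm_eq_tsum_rpow (by simp)]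
  simp only [ENNReal.toReal_one, Real.rpow_one, div_one, Real.norm_eq_abs]
  change ∑' x, |μ x| = _
  exact tsum_eq_sum (s := μ.support) fun x hx => by simp [Finsupp.notMem_support_iff.1 hx]

lemma convex_finsupp_probability (X : Type*) :
    Convex ℝ {μ : X →₀ ℝ | (∀ x, 0 ≤ μ x) ∧ (μ.sum fun _ r => r) = 1} := by
  rintro μ ⟨hμ, hμ1⟩ ν ⟨hν, hν1⟩ a b ha hb hab
  refine ⟨fun x => ?_, ?_⟩
  · have := hμ x; have := hν x
    simp only [Finsupp.add_apply, Finsupp.smul_apply, smul_eq_mul]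
    positivity
  · rw [Finsupp.sum_add_index' (by simp) (by simp), Finsupp.sum_smul_index (by simp),
      Finsupp.sum_smul_index (by simp), ← Finsupp.mul_sum, ← Finsupp.mul_sum, hμ1, hν1, mul_one,
      mul_one, hab]

/-- If the convex set of all tuples `(s μ - μ)` misses the `ε`-ball, a functional separates them.
Its coordinates are bounded functions `f s` for which the sum of `leftTranslate s (f s) - f s` is at
least some `c > 0` everywhere, yet an invariant mean sends this sum to `0`. -/
theorem HasLeftInvariantMean.hasAlmostInvariantDistributions {S : Type*} [Monoid S]
    (h : HasLeftInvariantMean S) : HasAlmostInvariantDistributions S := by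
  classical
  obtain ⟨m, hm⟩ := h
  intro A ε hε
  let D : (S →₀ ℝ) →ₗ[ℝ] (A → lp (fun _ : S => ℝ) 1) := LinearMap.pi fun s =>
    finsuppToLpOne S ∘ₗ (Finsupp.lmapDomain ℝ ℝ (fun x => (s : S) * x) - LinearMap.id)
  let P : Set (S →₀ ℝ) := {μ | (∀ x, 0 ≤ μ x) ∧ (μ.sum fun _ r => r) = 1}
  by_contra hcon
  have hdisj : Disjoint (Metric.ball 0 ε) (D '' P) := by
    rw [Set.disjoint_left]
    rintro _ hball ⟨μ, hμ, rfl⟩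
    refine hcon ⟨μ, hμ.1, hμ.2, fun s hs => ?_⟩
    rw [mem_ball_zero_iff, pi_norm_lt_iff hε] at hball
    rw [← norm_finsuppToLpOne]
    exact hball ⟨s, hs⟩
  obtain ⟨φ, c, hlt, hle⟩ := geometric_hahn_banach_open (convex_ball 0 ε) Metric.isOpen_ball
    ((convex_finsupp_probability S).linear_image D) hdisj
  have hc : 0 < c := by simpa using hlt 0 (Metric.mem_ball_self hε)
  let δ : S → lp (fun _ : S => ℝ) 1 := fun x => finsuppToLpOne S (Finsupp.single x 1)
  have hδ (x : S) : ‖δ x‖ = 1 := by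
    rw [norm_finsuppToLpOne, Finsupp.sum_single_index (by simp), abs_one]
  let f : A → lp (fun _ : S => ℝ) ∞ := fun s => ⟨fun x => φ (Pi.single s (δ x)),
    memℓp_infty ⟨‖φ‖, by
      rintro _ ⟨x, rfl⟩
      refine (φ.le_opNorm _).trans ?_
      rw [Pi.norm_single, hδ, mul_one]⟩⟩
  have hD (x : S) : D (Finsupp.single x 1) = ∑ s : A, Pi.single s (δ (s * x) - δ x) := by
    rw [Finset.univ_sum_single]
    funext s
    simp [D, δ, Finsupp.mapDomain_single]
  let F : lp (fun _ : S => ℝ) ∞ := ∑ s : A, (leftTranslate (s : S) (f s) - f s)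
  have hF (x : S) : F x = φ (D (Finsupp.single x 1)) := by
    rw [hD, map_sum, lp.coeFn_sum, Finset.sum_apply]
    refine Finset.sum_congr rfl fun s _ => ?_
    rw [Pi.single_sub, map_sub]
    rfl
  have h0 : m.toLinearMap F = 0 := by
    rw [map_sum]
    exact Finset.sum_eq_zero fun s _ => by rw [map_sub, hm, sub_self]
  have hge := m.nonneg (F - c • 1) fun x => by
    change 0 ≤ F x - c * 1
    rw [hF, mul_one, sub_nonneg]
    refine hle _ ⟨_, ⟨fun y => ?_, by simp⟩, rfl⟩
    rw [Finsupp.single_apply]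
    split_ifs <;> norm_num
  rw [map_sub, map_smul, m.map_one, h0, smul_eq_mul] at hge
  linarith

/-! ### Fixed points from almost invariant distributions -/

section FixedPoint

variable {V : Type*} [AddCommGroup V] [Module ℝ V]

lemma Convex.exists_sum_eq_smul {K : Set V} (hK : Convex ℝ K) (hne : K.Nonempty)
    {X : Type*} (t : Finset X) (w : X → ℝ) (hw : ∀ x, 0 ≤ w x) (v : X → K) :
    ∃ k ∈ K, ∑ x ∈ t, w x • (v x : V) = (∑ x ∈ t, w x) • k := by
  rcases (Finset.sum_nonneg fun x _ => hw x : 0 ≤ ∑ x ∈ t, w x).eq_or_lt with h | h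
  · obtain ⟨k, hk⟩ := hne
    refine ⟨k, hk, ?_⟩
    rw [← h, zero_smul]
    refine Finset.sum_eq_zero fun x hx => ?_
    rw [(Finset.sum_eq_zero_iff_of_nonneg fun x _ => hw x).1 h.symm x hx, zero_smul]
  · refine ⟨t.centerMass w fun x => (v x : V),
      hK.centerMass_mem (fun x _ => hw x) h fun x _ => (v x).2, ?_⟩
    rw [Finset.centerMass, smul_inv_smul₀ h.ne']

lemma IsAffineSelfMap.map_sum {K : Set V} (hK : Convex ℝ K) {f : K → K} (hf : IsAffineSelfMap f)
    {X : Type*} (t : Finset X) (w : X → ℝ) (hw : ∀ x ∈ t, 0 ≤ w x) (hw1 : ∑ x ∈ t, w x = 1)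
    (v : X → K) (z : K) (hz : (z : V) = ∑ x ∈ t, w x • (v x : V)) :
    (f z : V) = ∑ x ∈ t, w x • (f (v x) : V) := by
  -- The graph of an affine map is convex, hence closed under finite convex combinations.
  have hG : Convex ℝ (Set.range fun x : K => ((x : V), (f x : V))) := by
    rintro _ ⟨x, rfl⟩ _ ⟨y, rfl⟩ a b ha hb hab
    let z : K := ⟨a • (x : V) + b • (y : V), hK x.2 y.2 ha hb hab⟩
    exact ⟨z, Prod.ext rfl (hf x y z a b ha hb hab rfl)⟩
  obtain ⟨z', hz'⟩ := hG.sum_mem hw hw1 fun x _ => Set.mem_range_self (v x)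
  have h1 := congrArg Prod.fst hz'
  have h2 := congrArg Prod.snd hz'
  simp only [Prod.fst_sum, Prod.snd_sum, Prod.smul_fst, Prod.smul_snd] at h1 h2
  rw [← hz] at h1
  rw [← h2, Subtype.ext h1]

/-- The positive and negative parts of `ν` each have mass at most its `ℓ¹`-norm, and each
contributes its mass times a point of `K`. -/
lemma Convex.exists_finsupp_sum_eq_smul_sub_smul {K : Set V} (hK : Convex ℝ K) (hne : K.Nonempty)
    {X : Type*} (ν : X →₀ ℝ) (v : X → K) {ε : ℝ} (hν : (ν.sum fun _ r => |r|) < ε) :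
    ∃ a b : ℝ, |a| ≤ ε ∧ |b| ≤ ε ∧ ∃ k ∈ K, ∃ l ∈ K,
      (ν.sum fun x r => r • (v x : V)) = a • k - b • l := by
  obtain ⟨k, hk, hk'⟩ := hK.exists_sum_eq_smul hne ν.support (fun x => (ν x)⁺)
    (fun x => posPart_nonneg _) v
  obtain ⟨l, hl, hl'⟩ := hK.exists_sum_eq_smul hne ν.support (fun x => (ν x)⁻)
    (fun x => negPart_nonneg _) v
  refine ⟨∑ x ∈ ν.support, (ν x)⁺, ∑ x ∈ ν.support, (ν x)⁻, ?_, ?_, k, hk, l, hl, ?_⟩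
  rotate_left 2
  · rw [← hk', ← hl', ← Finset.sum_sub_distrib, Finsupp.sum]
    refine Finset.sum_congr rfl fun x _ => ?_
    rw [← sub_smul, posPart_sub_negPart]
  all_goals
    rw [abs_of_nonneg (Finset.sum_nonneg fun x _ => by positivity)]
    refine (Finset.sum_le_sum fun x _ => ?_).trans hν.le
  · exact sup_le (le_abs_self _) (abs_nonneg _)
  · exact sup_le (neg_le_abs _) (abs_nonneg _)

variable [TopologicalSpace V] [IsTopologicalAddGroup V] [ContinuousSMul ℝ V] [T2Space V]

theorem HasAlmostInvariantDistributions.exists_fixedPoint {S : Type*} [Monoid S]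
    (h : HasAlmostInvariantDistributions S) {K : Set V} (hK : Convex ℝ K) (hc : IsCompact K)
    (hne : K.Nonempty) (φ : S →* Function.End K) (g : ℕ → S)
    (hcont : ∀ i, Continuous (φ (g i))) (haff : ∀ i, IsAffineSelfMap (φ (g i))) :
    ∃ p : K, ∀ i, φ (g i) p = p := by
  classical
  obtain ⟨p, hp⟩ := hne
  let o : S → K := fun x => φ x ⟨p, hp⟩
  choose μ hμ0 hμ1 hμ using fun n : ℕ =>
    h ((Finset.range n).image g) (1 / ((n : ℝ) + 1)) (by positivity)
  -- The orbit of `p` averaged against `μ n`; its displacement under `g i` is the integral of the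
  -- orbit against `g i μ - μ`.
  let q : ℕ → K := fun n => ⟨∑ x ∈ (μ n).support, μ n x • (o x : V),
    hK.sum_mem (fun x _ => hμ0 n x) (hμ1 n) fun x _ => (o x).2⟩
  have hφq (i n : ℕ) : ((φ (g i) (q n) : K) : V) - q n =
      (Finsupp.mapDomain (fun x => g i * x) (μ n) - μ n).sum fun x r => r • (o x : V) := by
    rw [Finsupp.sum_sub_index fun x a b => sub_smul a b (o x : V),
      Finsupp.sum_mapDomain_index (by simp) fun x a b => add_smul a b (o x : V)]
    congr 1
    rw [(haff i).map_sum hK _ _ (fun x _ => hμ0 n x) (hμ1 n) o (q n) rfl]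
    refine Finset.sum_congr rfl fun x _ => ?_
    simp only [o, map_mul]
    rfl
  let U : Ultrafilter ℕ := hyperfilter ℕ
  have : CompactSpace K := isCompact_iff_compactSpace.1 hc
  obtain ⟨z, -, hz⟩ := isCompact_univ.ultrafilter_le_nhds (U.map q) (by simp)
  have hz : Tendsto q U (𝓝 z) := hz
  refine ⟨z, fun i => Subtype.ext (sub_eq_zero.1 ?_)⟩
  refine tendsto_nhds_unique ((continuous_subtype_val.tendsto _).comp
    (((hcont i).tendsto z).comp hz) |>.sub ((continuous_subtype_val.tendsto _).comp hz)) ?_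
  -- Since `μ n` is controlled only for `g 0, …, g (n - 1)`, the values for `n ≤ i` are dummies.
  have hex (n : ℕ) : ∃ a b : ℝ, ∃ k ∈ K, ∃ l ∈ K, (i < n → |a| ≤ 1 / ((n : ℝ) + 1) ∧
      |b| ≤ 1 / ((n : ℝ) + 1)) ∧ (i < n → ((φ (g i) (q n) : K) : V) - q n = a • k - b • l) := by
    by_cases hin : i < n
    · obtain ⟨a, b, ha, hb, k, hk, l, hl, hkl⟩ := hK.exists_finsupp_sum_eq_smul_sub_smul ⟨p, hp⟩ _ o
        (hμ n (g i) (Finset.mem_image_of_mem g (Finset.mem_range.2 hin)))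
      exact ⟨a, b, k, hk, l, hl, fun _ => ⟨ha, hb⟩, fun _ => by rw [hφq, hkl]⟩
    · exact ⟨0, 0, p, hp, p, hp, fun h => absurd h hin, fun h => absurd h hin⟩
  choose a b k hk l hl hab hkl using hex
  have hbdd := hc.isVonNBounded ℝ
  have ha : Tendsto a atTop (𝓝 0) := squeeze_zero_norm'
    ((eventually_gt_atTop i).mono fun n hn => (hab n hn).1)
    tendsto_one_div_add_atTop_nhds_zero_nat
  have hb : Tendsto b atTop (𝓝 0) := squeeze_zero_norm'
    ((eventually_gt_atTop i).mono fun n hn => (hab n hn).2)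
    tendsto_one_div_add_atTop_nhds_zero_nat
  -- Scalars tending to `0` times points of a bounded set tend to `0`.
  have hlim := (hbdd.smul_tendsto_zero (.of_forall hk) ha).sub
    (hbdd.smul_tendsto_zero (.of_forall hl) hb)
  rw [sub_zero] at hlim
  refine (hlim.congr' ?_).mono_left Nat.hyperfilter_le_atTop
  filter_upwards [eventually_gt_atTop i] with n hn
  exact (hkl n hn).symm

end FixedPoint

/-! ### Amenability of the facial monoid -/

namespace FacialMonoid

theorem hasAlmostInvariantDistributions : HasAlmostInvariantDistributions FacialMonoid :=
  hasLeftInvariantMean.hasAlmostInvariantDistributions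

theorem hasAffineFixedPointProperty : HasAffineFixedPointProperty.{u} FacialMonoid := by
  intro V _ _ _ _ _ _ _ K hf hmaps hK hc hne
  let φ : FacialMonoid →* Function.End K :=
    { toFun := fun s x => ⟨s • (x : V), hmaps s x x.2⟩
      map_one' := funext fun x => Subtype.ext (one_smul FacialMonoid (x : V))
      map_mul' := fun s t => funext fun x => Subtype.ext (mul_smul s t (x : V)) }
  obtain ⟨p, hp⟩ := hasAlmostInvariantDistributions.exists_fixedPoint hK hc hne φ gen
    (fun i => by
      obtain ⟨f, hf⟩ := hf (gen i)
      exact ((f.continuous.comp continuous_subtype_val).congr fun x => hf x).subtype_mk _)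
    (fun i x y z a b _ _ hab hz => by
      obtain ⟨f, hf⟩ := hf (gen i)
      change gen i • (z : V) = a • gen i • (x : V) + b • gen i • (y : V)
      rw [← hf, ← hf, ← hf, hz]
      exact Convex.combo_affine_apply (f := (f : V →ᵃ[ℝ] V)) hab)
  refine ⟨p, p.2, fun s => ?_⟩
  induction s using induction_gen with
  | one => exact one_smul FacialMonoid (p : V)
  | mul i s ih => rw [mul_smul, ih]; exact congrArg Subtype.val (hp i)

theorem isLeftAmenable : IsLeftAmenable.{u} FacialMonoid :=
  ⟨hasAffineFixedPointProperty, hasLeftInvariantMean, hasAlmostInvariantDistributions⟩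

end FacialMonoid

theorem theoremB :
    (∀ (V : Type u) [AddCommGroup V] [Module ℝ V] [TopologicalSpace V] [IsTopologicalAddGroup V]
      [ContinuousSMul ℝ V] [T2Space V] (K : Set V),
      Convex ℝ K → IsCompact K → K.Nonempty →
      ∀ s : ℕ+ → K → K,
        (∀ i, Continuous (s i)) →
        (∀ i, IsAffineSelfMap (s i)) →
        (∀ i j : ℕ+, i ≤ j → s j ∘ s i = s i ∘ s (j + 1)) →
        ∃ p : K, ∀ i, s i p = p) ∧
    IsLeftAmenable.{u, 0} FacialMonoid := by
  refine ⟨?_, FacialMonoid.isLeftAmenable⟩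
  intro V _ _ _ _ _ _ K hK hc hne s hcont haff hrel
  let φ : FacialMonoid →* Function.End K := PresentedMonoid.lift (M := Function.End K) s (by
    rintro _ _ ⟨i, j, hij⟩
    rw [map_mul, map_mul]
    exact hrel i j hij)
  obtain ⟨p, hp⟩ := FacialMonoid.hasAlmostInvariantDistributions.exists_fixedPoint hK hc hne φ
    FacialMonoid.gen (fun i => hcont i.succPNat) (fun i => haff i.succPNat)
  refine ⟨p, fun i => ?_⟩
  have := hp i.natPred
  rwa [FacialMonoid.gen, PNat.succPNat_natPred] at this
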